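/- **Setting.** Let $E$ be a category with finite products and let $J$ be a subcanonical Grothendieck topology on $E$ (for example, $E$ a Grothendieck topos with its canonical topology). An element of an object $A$ at stage $X$ is a morphism $X\to A$. Subsets, maps and equations below are understood on elements at all stages, naturally in the stage, and "locally" means on a $J$-covering family of the stage. Let $R$ be a commutative ring object in $E$ in which every positive integer is invertible. For $k,n\ge 0$ let $D_k(n)\subseteq R^n$ be the set of those $d=(d_1,\dots,d_n)$ for which every product of $k+1$ (not necessarily distinct) coordinates is $0$, and put $D(n)=D_1(n)$. An associative unital $R$-algebra $W$ in $E$ is called KL if for all $k,n$ and every stage $X$, every map $f\colon X\times D_k(n)\to W$ has the form $f(x,d)=\sum_{|\alpha|\le k} d^{\alpha}c_\alpha(x)$ with unique maps $c_\alpha\colon X\to W$. Assume that $R$ itself is KL. A *matrix group* is a group object $G$ in $E$ that admits a multiplicative unit-preserving monomorphism into a KL $R$-algebra $W$. Elements $x,y$ of an object $M$ are *neighbours*, $x\sim y$, if locally there are $n$, a map $f\colon D(n)\to M$ and $d\in D(n)$ with $f(0)=x$ and $f(d)=y$. A subobject $U\subseteq M$ is *formally open* if $x\in U$ and $x\sim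 y$ imply $y\in U$. $M$ is a *formal manifold* if it is covered by formally open subobjects $U$, each isomorphic to a subset of some $R^n$ that is closed under adding elements of $D(n)$. Let $M$ be a formal manifold and $\Phi\rightrightarrows M$ a groupoid object in $E$; arrows are composed from left to right. A *connection* in $\Phi$ is a map $\nabla$ assigning to each pair $x\sim y$ in $M$ an arrow $\nabla(x,y)\colon x\to y$ of $\Phi$, such that $\nabla(x,x)=1_x$ and $\nabla(y,x)=\nabla(x,y)^{-1}$. It is *flat* if $\nabla(x,y)\,\nabla(y,z)=\nabla(x,z)$ whenever $x\sim y$, $y\sim z$ and $x\sim z$. An *$n$-path* is a tuple $\underline x=(x_0,\dots,x_n)$ of elements of $M$ with $x_i\sim x_{i+1}$ for $0\le i<n$, and $$\nabla^{*n}(\underline x)=\nabla(x_0,x_1)\,\nabla(x_1,x_2)\cdots\nabla(x_{n-1},x_n)\colon x_0\to x_n$$ (the identity of $x_0$ if $n=0$). **Proposition.** Assume that $M$ is covered by formally open subobjects $U$ for each of which there are a matrix group $G$ and an isomorphism over $U$ from the restriction of $\Phi$ to $U$ to the groupoid $U\times G\times U$ (whose arrows $u\to v$ are the elements of $G$, composed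 by multiplication). Let $\nabla$ be a flat connection in $\Phi$. Then for every $n\ge 0$ the law $\nabla^{*n}$ is holonomous: $\nabla^{*n}(\underline x)$ depends only on $x_0$ and $x_n$. That is, any two $n$-paths with the same first point and the same last point (at any stage) have the same value under $\nabla^{*n}$. -/

import Mathlib

open CategoryTheory MonoidalCategory
open scoped MonObj AddMonObj RingObj CommRingObj

universe v u

/-!
Synthetic differential geometry over a line object `R` in a category `E` with finite products,
formulated with generalised elements. For an object `A`, the elements of `A` at stage `X` are the
morphisms `X ⟶ A`; an operation, or a map out of a (not necessarily representable) subset of a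
product, is given on elements at every stage, naturally in the stage. By the Yoneda lemma this is
the usual internal notion whenever the subset in question is represented by an object of `E`
(for instance in a topos). Local existence refers to a subcanonical Grothendieck topology `J`; for
a Grothendieck topos with its canonical topology it means: on a jointly epimorphic family.
-/

namespace SDG

variable {E : Type u} [Category.{v} E] [CartesianMonoidalCategory E] [BraidedCategory E]

/-- The ring object `R` contains the rational numbers: positive integers are invertible. -/
def ContainsRationals (R : E) [CommRingObj R] : Prop :=
  ∀ (X : E) (n : ℕ), n ≠ 0 → IsUnit (n : X ⟶ R)

/-- The infinitesimal object `D_k(n) ⊆ R^n`: those `d` all of whose `(k+1)`-fold products of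
coordinates vanish. In particular `D_1(n) = D(n)` consists of the first order infinitesimal
vectors. -/
def InD {R : E} [CommRingObj R] {X : E} (k : ℕ) {n : ℕ} (d : Fin n → (X ⟶ R)) : Prop :=
  ∀ a : Fin (k + 1) → Fin n, ∏ i, d (a i) = 0

theorem InD.comp {R : E} [CommRingObj R] {X Y : E} (f : Y ⟶ X) {k n : ℕ}
    {d : Fin n → (X ⟶ R)} (h : InD k d) : InD k (fun i => f ≫ d i) := by
  intro a
  have h1 : ∏ i, f ≫ d (a i) = f ≫ ∏ i, d (a i) :=
    (map_prod ((yonedaCommRingObj R).map f.op).hom (fun i => d (a i)) Finset.univ).symm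
  have h2 : f ≫ (0 : X ⟶ R) = 0 := map_zero ((yonedaCommRingObj R).map f.op).hom
  rw [h1, h a, h2]

theorem InD.zero {R : E} [CommRingObj R] {X : E} {k n : ℕ} :
    InD k (fun _ : Fin n => (0 : X ⟶ R)) := by
  intro a
  simp

/-- A map `X × D_k(n) → A`. -/
structure InfMap (R : E) [CommRingObj R] (X : E) (k n : ℕ) (A : E) where
  app : ∀ {Y : E} (_ : Y ⟶ X) (d : Fin n → (Y ⟶ R)), InD k d → (Y ⟶ A)
  natural : ∀ {Y Z : E} (f : Z ⟶ Y) (y : Y ⟶ X) (d : Fin n → (Y ⟶ R)) (h : InD k d),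
    f ≫ app y d h = app (f ≫ y) (fun i => f ≫ d i) (h.comp f)

/-- Exponents of monomials in `n` variables of total degree at most `k`. -/
abbrev MultiIndex (n k : ℕ) : Type :=
  {α : Fin n → Fin (k + 1) // ∑ i, (α i : ℕ) ≤ k}

/-- The Kock–Lawvere property of an `R`-algebra `W` with structure map `s : R → W`: for all `k`
and `n`, every map `D_k(n) → W` is given by a unique polynomial of degree at most `k` with
coefficients in `W`. Being an internal statement, it is required at every stage `X`, i.e. for maps
`X × D_k(n) → W`, with coefficients `X → W`. -/
def IsKL {R W : E} [CommRingObj R] [RingObj W] (s : R ⟶ W) : Prop :=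
  ∀ (k n : ℕ) (X : E) (F : InfMap R X k n W),
    ∃! c : MultiIndex n k → (X ⟶ W),
      ∀ (Y : E) (y : Y ⟶ X) (d : Fin n → (Y ⟶ R)) (h : InD k d),
        F.app y d h = ∑ α : MultiIndex n k, ((∏ i, d i ^ (α.1 i : ℕ)) ≫ s) * (y ≫ c α)

/-- A realisation of the group object `G` as a matrix group: a multiplicative embedding of `G` in
an associative unital `R`-algebra `W` which is a KL vector space. The algebra structure of the
ring object `W` is given by its structure map `R → W`, a ring homomorphism with central values. -/
structure MatrixEmbedding (R : E) [CommRingObj R] (G : E) [GrpObj G] where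
  W : E
  [ringObj : RingObj W]
  scalar : R ⟶ W
  [isRingHom : IsRingHom scalar]
  central : ∀ {X : E} (r : X ⟶ R) (w : X ⟶ W), (r ≫ scalar) * w = w * (r ≫ scalar)
  isKL : IsKL scalar
  emb : G ⟶ W
  [mono : Mono emb]
  [isMonHom : IsMonHom emb]

/-- `x` and `y` are values, at `0` and at some `d ∈ D(n)`, of a map `D(n) → M`. -/
def DNbr (R : E) [CommRingObj R] {M X : E} (x y : X ⟶ M) : Prop :=
  ∃ (n : ℕ) (F : InfMap R X 1 n M) (d : Fin n → (X ⟶ R)) (h : InD 1 d),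
    F.app (𝟙 X) (fun _ => 0) InD.zero = x ∧ F.app (𝟙 X) d h = y

/-- The first order neighbour relation `x ∼ y` on `M`: locally, `x` and `y` are values, at `0` and
at some `d ∈ D(n)`, of a map `D(n) → M`. -/
def Nbr (J : GrothendieckTopology E) (R : E) [CommRingObj R] {M X : E} (x y : X ⟶ M) : Prop :=
  ∃ S ∈ J X, ∀ ⦃Y : E⦄ (f : Y ⟶ X), S f → DNbr R (f ≫ x) (f ≫ y)

theorem DNbr.refl {R : E} [CommRingObj R] {M X : E} (x : X ⟶ M) : DNbr R x x :=
  ⟨0, ⟨fun y _ _ => y ≫ x, by simp⟩, fun _ => 0, InD.zero, by simp, by simp⟩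

theorem DNbr.comp {R : E} [CommRingObj R] {M X Y : E} {x y : X ⟶ M} (f : Y ⟶ X)
    (h : DNbr R x y) : DNbr R (f ≫ x) (f ≫ y) := by
  obtain ⟨n, F, d, hd, rfl, rfl⟩ := h
  have h2 : f ≫ (0 : X ⟶ R) = 0 := map_zero ((yonedaCommRingObj R).map f.op).hom
  refine ⟨n, ⟨fun y d h => F.app (y ≫ f) d h, fun g y d h => ?_⟩, fun i => f ≫ d i, hd.comp f,
    ?_, ?_⟩
  · simp [F.natural]
  · simp [F.natural, h2]
  · simp [F.natural]

theorem Nbr.refl {J : GrothendieckTopology E} {R : E} [CommRingObj R] {M X : E} (x : X ⟶ M) :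
    Nbr J R x x :=
  ⟨⊤, J.top_mem X, fun _ _ _ => DNbr.refl _⟩

theorem Nbr.comp {J : GrothendieckTopology E} {R : E} [CommRingObj R] {M X Y : E} {x y : X ⟶ M}
    (f : Y ⟶ X) (h : Nbr J R x y) : Nbr J R (f ≫ x) (f ≫ y) := by
  obtain ⟨S, hS, h⟩ := h
  refine ⟨S.pullback f, J.pullback_stable f hS, fun Z g hg => ?_⟩
  simpa using h (g ≫ f) hg

/-- The subobject `φ : U → M` is formally open: `x ∈ U` and `x ∼ y` imply `y ∈ U`. -/
structure IsFormallyOpen (J : GrothendieckTopology E) (R : E) [CommRingObj R] {U M : E}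
    (φ : U ⟶ M) : Prop where
  mono : Mono φ
  closed : ∀ {X : E} (u : X ⟶ U) (y : X ⟶ M), Nbr J R (u ≫ φ) y → ∃ v : X ⟶ U, v ≫ φ = y

/-- `φ : U → M` is a chart: it is the inclusion of a formally open subset, and the coordinate
functions on `U` identify `U` with a formally open subset of some `R^n`, i.e. one that is closed
under adding elements of `D(n)`. -/
def IsChart (J : GrothendieckTopology E) (R : E) [CommRingObj R] {U M : E} (φ : U ⟶ M) : Prop :=
  IsFormallyOpen J R φ ∧
  ∃ (n : ℕ) (coord : Fin n → (U ⟶ R)),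
    (∀ {X : E} (u v : X ⟶ U), (∀ i, u ≫ coord i = v ≫ coord i) → u = v) ∧
    (∀ {X : E} (u : X ⟶ U) (d : Fin n → (X ⟶ R)), InD 1 d →
      ∃ v : X ⟶ U, ∀ i, v ≫ coord i = u ≫ coord i + d i)

/-- `M` is a formal manifold: it is covered by charts. -/
def IsFormalManifold (J : GrothendieckTopology E) (R : E) [CommRingObj R] (M : E) : Prop :=
  ∀ {X : E} (x : X ⟶ M), ∃ S ∈ J X, ∀ ⦃Y : E⦄ (f : Y ⟶ X), S f →
    ∃ (U : E) (φ : U ⟶ M), IsChart J R φ ∧ ∃ u : Y ⟶ U, u ≫ φ = f ≫ x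

/-- A groupoid object `Φ ⇉ M` in `E` with object of objects `M`. Composition is written from left
to right. -/
structure GroupoidObj (M : E) where
  arr : E
  src : arr ⟶ M
  tgt : arr ⟶ M
  comp : ∀ {X : E} (f g : X ⟶ arr), f ≫ tgt = g ≫ src → (X ⟶ arr)
  comp_natural : ∀ {X Y : E} (k : Y ⟶ X) (f g : X ⟶ arr) (h : f ≫ tgt = g ≫ src),
    k ≫ comp f g h = comp (k ≫ f) (k ≫ g) (by simp [h])
  comp_src : ∀ {X : E} (f g : X ⟶ arr) (h : f ≫ tgt = g ≫ src), comp f g h ≫ src = f ≫ src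
  comp_tgt : ∀ {X : E} (f g : X ⟶ arr) (h : f ≫ tgt = g ≫ src), comp f g h ≫ tgt = g ≫ tgt
  one : M ⟶ arr
  one_src : one ≫ src = 𝟙 M
  one_tgt : one ≫ tgt = 𝟙 M
  inv : arr ⟶ arr
  inv_src : inv ≫ src = tgt
  inv_tgt : inv ≫ tgt = src
  assoc : ∀ {X : E} (f g h : X ⟶ arr) (hfg : f ≫ tgt = g ≫ src) (hgh : g ≫ tgt = h ≫ src),
    comp (comp f g hfg) h (by rw [comp_tgt, hgh]) = comp f (comp g h hgh) (by rw [comp_src, hfg])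
  one_comp : ∀ {X : E} (f : X ⟶ arr), comp (f ≫ src ≫ one) f (by simp [one_tgt]) = f
  comp_one : ∀ {X : E} (f : X ⟶ arr), comp f (f ≫ tgt ≫ one) (by simp [one_src]) = f
  inv_comp : ∀ {X : E} (f : X ⟶ arr), comp (f ≫ inv) f (by simp [inv_tgt]) = f ≫ tgt ≫ one
  comp_inv : ∀ {X : E} (f : X ⟶ arr), comp f (f ≫ inv) (by simp [inv_src]) = f ≫ src ≫ one

namespace GroupoidObj

variable {M : E} (Φ : GroupoidObj M)

/-- Arrows `x → y` of `Φ`, for `x` and `y` elements of `M` at stage `X`. -/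
def Hom {X : E} (x y : X ⟶ M) : Type v :=
  {a : X ⟶ Φ.arr // a ≫ Φ.src = x ∧ a ≫ Φ.tgt = y}

/-- The identity arrow `1_x`. -/
def homOne {X : E} (x : X ⟶ M) : Φ.Hom x x :=
  ⟨x ≫ Φ.one, by simp [Φ.one_src], by simp [Φ.one_tgt]⟩

/-- Composition of arrows, from left to right. -/
def homComp {X : E} {x y z : X ⟶ M} (a : Φ.Hom x y) (b : Φ.Hom y z) : Φ.Hom x z :=
  ⟨Φ.comp a.1 b.1 (a.2.2.trans b.2.1.symm), by rw [Φ.comp_src, a.2.1], by rw [Φ.comp_tgt, b.2.2]⟩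

/-- The inverse of an arrow. -/
def homInv {X : E} {x y : X ⟶ M} (a : Φ.Hom x y) : Φ.Hom y x :=
  ⟨a.1 ≫ Φ.inv, by simp [Φ.inv_src, a.2.2], by simp [Φ.inv_tgt, a.2.1]⟩

/-- An isomorphism over `U` from the restriction of `Φ` to the subobject `φ : U → M` to the groupoid
`U × G × U`, in which an arrow `u → v` is an element of `G` and composition is multiplication. -/
structure Trivialization {U : E} (φ : U ⟶ M) (G : E) [GrpObj G] where
  equiv : ∀ {X : E} (u v : X ⟶ U), Φ.Hom (u ≫ φ) (v ≫ φ) ≃ (X ⟶ G)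
  natural : ∀ {X Y : E} (f : Y ⟶ X) (u v : X ⟶ U) (a : Φ.Hom (u ≫ φ) (v ≫ φ))
    (b : Φ.Hom ((f ≫ u) ≫ φ) ((f ≫ v) ≫ φ)), b.1 = f ≫ a.1 →
      equiv (f ≫ u) (f ≫ v) b = f ≫ equiv u v a
  map_comp : ∀ {X : E} (u v w : X ⟶ U) (a : Φ.Hom (u ≫ φ) (v ≫ φ)) (b : Φ.Hom (v ≫ φ) (w ≫ φ)),
    equiv u w (Φ.homComp a b) = equiv u v a * equiv v w b

/-- `M` is covered by formally open subsets `U` over which `Φ` is isomorphic to `U × G × U` for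
some matrix group `G` (which may depend on `U`). -/
def IsLocallyTrivial (J : GrothendieckTopology E) (R : E) [CommRingObj R] : Prop :=
  ∀ {X : E} (x : X ⟶ M), ∃ S ∈ J X, ∀ ⦃Y : E⦄ (f : Y ⟶ X), S f →
    ∃ (U : E) (φ : U ⟶ M), IsFormallyOpen J R φ ∧ (∃ u : Y ⟶ U, u ≫ φ = f ≫ x) ∧
      ∃ (G : E) (_ : GrpObj G),
        Nonempty (MatrixEmbedding R G) ∧ Nonempty (Φ.Trivialization φ G)

end GroupoidObj

/-- A connection in the groupoid `Φ ⇉ M`: a map `∇ : M_(1) → Φ` over `M × M`, where `M_(1)` is the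
set of pairs of neighbours, with `∇(x,x) = 1_x` and `∇(y,x) = ∇(x,y)⁻¹`. -/
structure Connection (J : GrothendieckTopology E) (R : E) [CommRingObj R] {M : E}
    (Φ : GroupoidObj M) where
  val : ∀ {X : E} (x y : X ⟶ M), Nbr J R x y → Φ.Hom x y
  natural : ∀ {X Y : E} (f : Y ⟶ X) (x y : X ⟶ M) (h : Nbr J R x y),
    (val (f ≫ x) (f ≫ y) (h.comp f)).1 = f ≫ (val x y h).1
  val_self : ∀ {X : E} (x : X ⟶ M), val x x (Nbr.refl x) = Φ.homOne x
  val_symm : ∀ {X : E} (x y : X ⟶ M) (h : Nbr J R x y) (h' : Nbr J R y x),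
    val y x h' = Φ.homInv (val x y h)

/-- An `n`-path in `M` (at stage `X`): an `(n+1)`-tuple of points with consecutive points being
neighbours. -/
structure NPath (J : GrothendieckTopology E) (R : E) [CommRingObj R] (M X : E) (n : ℕ) where
  pt : Fin (n + 1) → (X ⟶ M)
  adj : ∀ i : Fin n, Nbr J R (pt i.castSucc) (pt i.succ)

namespace NPath

variable {J : GrothendieckTopology E} {R : E} [CommRingObj R] {M X : E}

/-- Change of stage. -/
def restrict {Y : E} (f : Y ⟶ X) {n : ℕ} (p : NPath J R M X n) : NPath J R M Y n :=
  ⟨fun i => f ≫ p.pt i, fun i => (p.adj i).comp f⟩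

/-- The path `(x_0, …, x_n)` of a path `(x_0, …, x_n, x_{n+1})`. -/
def init {n : ℕ} (p : NPath J R M X (n + 1)) : NPath J R M X n :=
  ⟨fun i => p.pt i.castSucc, fun i => p.adj i.castSucc⟩

end NPath

/-- A non-holonomous (i.e. not necessarily holonomous) connection of order `n`: a law which to an
`n`-path associates an arrow from its first to its last point. -/
structure NonHolonomousConnection (J : GrothendieckTopology E) (R : E) [CommRingObj R] {M : E}
    (Φ : GroupoidObj M) (n : ℕ) where
  val : ∀ {X : E} (p : NPath J R M X n), Φ.Hom (p.pt 0) (p.pt (Fin.last n))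
  natural : ∀ {X Y : E} (f : Y ⟶ X) (p : NPath J R M X n), (val (p.restrict f)).1 = f ≫ (val p).1

/-- The value on an `n`-path depends only on the two end points of the path. -/
def NonHolonomousConnection.IsHolonomous {J : GrothendieckTopology E} {R : E} [CommRingObj R]
    {M : E} {Φ : GroupoidObj M} {n : ℕ} (c : NonHolonomousConnection J R Φ n) : Prop :=
  ∀ {X : E} (p q : NPath J R M X n),
    p.pt 0 = q.pt 0 → p.pt (Fin.last n) = q.pt (Fin.last n) → (c.val p).1 = (c.val q).1

namespace Connection

variable {J : GrothendieckTopology E} {R : E} [CommRingObj R] {M : E} {Φ : GroupoidObj M}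
  (conn : Connection J R Φ)

/-- `∇` is flat: `∇(x,y).∇(y,z) = ∇(x,z)` for mutual neighbours `x, y, z`. -/
def IsFlat : Prop :=
  ∀ {X : E} (x y z : X ⟶ M) (hxy : Nbr J R x y) (hyz : Nbr J R y z) (hxz : Nbr J R x z),
    Φ.homComp (conn.val x y hxy) (conn.val y z hyz) = conn.val x z hxz

/-- The composite arrow `∇(x_0,x_1).∇(x_1,x_2). … .∇(x_{n-1},x_n)`. -/
def transport {X : E} : ∀ {n : ℕ} (p : NPath J R M X n), Φ.Hom (p.pt 0) (p.pt (Fin.last n))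
  | 0, p => Φ.homOne (p.pt 0)
  | n + 1, p => Φ.homComp (transport p.init)
      (conn.val (p.pt (Fin.last n).castSucc) (p.pt (Fin.last n).succ) (p.adj (Fin.last n)))

theorem transport_natural {X Y : E} (f : Y ⟶ X) :
    ∀ {n : ℕ} (p : NPath J R M X n),
      (conn.transport (p.restrict f)).1 = f ≫ (conn.transport p).1
  | 0, p => by simp [transport, GroupoidObj.homOne, NPath.restrict]
  | n + 1, p => by
      have h1 := transport_natural f p.init
      have h2 := conn.natural f _ _ (p.adj (Fin.last n))
      simp only [transport, GroupoidObj.homComp]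
      rw [Φ.comp_natural]
      congr 1

/-- The non-holonomous connection `∇^{*n} = ∇ * ⋯ * ∇` of order `n` induced by `∇`. -/
def iterate (n : ℕ) : NonHolonomousConnection J R Φ n where
  val p := conn.transport p
  natural f p := conn.transport_natural f p

end Connection

end SDG

/-! The argument turns parallel transport into the exponential of an operator that sees only the
difference of the end points. Equality of arrows may be tested on a covering of the stage, so the
first point can be taken in the intersection of a chart and a formally open set that trivializes
`Φ`. Both sets are formally open, so the whole path stays in the intersection; there `∇(p, q)` is an
invertible element of a KL algebra `W`, and points have coordinates. For a `W`-valued function `a`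
the Kock–Lawvere property gives `∇(p, p + d) a(p + d) = a(p) + ∑ dᵢ (∂ᵢ a)(p)`, which defines
covariant derivatives `∂ᵢ`. Flatness, applied to `p`, `p + d`, `p + d + e`, makes them commute
(`deriv_commute`). Put `D_s = ∑ sᵢ ∂ᵢ`. For a single step `d` one has `D_d² = 0`, so the displayed
operator `1 + D_d` is `exp D_d`. The `D_s` commute and are additive in `s`, so the product over the
steps of a path is `exp D_{q - p}`, with `p` and `q` the end points (`exp_dirDeriv_app`). Rational
scalars are needed for this exponential. Evaluating it on the constant function `1` gives the
transport matrix, which determines the arrow (`transport_eq`). -/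

namespace SDG

variable {E : Type u} [Category.{v} E] [CartesianMonoidalCategory E] [BraidedCategory E]

/-- Representable presheaves are separated for a subcanonical topology. This is what allows
equations to be checked locally. -/
theorem hom_ext_of_cover {C : Type u} [Category.{v} C] {J : GrothendieckTopology C}
    [J.Subcanonical] {X A : C} {S : Sieve X} (hS : S ∈ J X) {a b : X ⟶ A}
    (h : ∀ ⦃Y : C⦄ (f : Y ⟶ X), S f → f ≫ a = f ≫ b) : a = b :=
  ((GrothendieckTopology.Subcanonical.isSheaf_of_isRepresentable (J := J) (yoneda.obj A)) S
    hS).isSeparatedFor.ext (fun _ f hf => h f hf)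

/-! ### Rings of elements at a stage, and change of stage. -/

section HomRing

variable {R W X Y : E} [RingObj W] [RingObj R]

/-- Change of stage, as a ring homomorphism. -/
def pull (W : E) [RingObj W] (f : Y ⟶ X) : (X ⟶ W) →+* (Y ⟶ W) :=
  ((yonedaRingObj W).map f.op).hom

theorem comp_mul' (f : Y ⟶ X) (a b : X ⟶ W) : f ≫ (a * b) = (f ≫ a) * (f ≫ b) :=
  map_mul (pull W f) a b

theorem comp_add' (f : Y ⟶ X) (a b : X ⟶ W) : f ≫ (a + b) = f ≫ a + f ≫ b :=
  map_add (pull W f) a b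

theorem comp_sub' (f : Y ⟶ X) (a b : X ⟶ W) : f ≫ (a - b) = f ≫ a - f ≫ b :=
  map_sub (pull W f) a b

theorem comp_neg' (f : Y ⟶ X) (a : X ⟶ W) : f ≫ (-a) = -(f ≫ a) :=
  map_neg (pull W f) a

theorem comp_zero' (f : Y ⟶ X) : f ≫ (0 : X ⟶ W) = 0 := map_zero (pull W f)

theorem comp_one' (f : Y ⟶ X) : f ≫ (1 : X ⟶ W) = 1 := map_one (pull W f)

/-- The map on elements at stage `X` induced by a homomorphism of ring objects. -/
def push (s : R ⟶ W) [IsRingHom s] (X : E) : (X ⟶ R) →+* (X ⟶ W) where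
  toFun a := a ≫ s
  map_one' := MonObj.one_comp _
  map_mul' _ _ := MonObj.mul_comp _ _ _
  map_zero' := AddMonObj.zero_comp _
  map_add' _ _ := AddMonObj.add_comp _ _ _

theorem push_apply (s : R ⟶ W) [IsRingHom s] (a : X ⟶ R) : push s X a = a ≫ s := rfl

theorem comp_push (s : R ⟶ W) [IsRingHom s] (f : Y ⟶ X) (a : X ⟶ R) :
    f ≫ push s X a = push s Y (f ≫ a) := by
  simp [push_apply]

end HomRing

/-! ### The Kock–Lawvere property in order one, and cancellation of infinitesimals. -/

section FirstOrder

variable {R W : E} [CommRingObj R] [RingObj W] {s : R ⟶ W} [IsRingHom s]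

theorem InD.mul_eq_zero {X : E} {n : ℕ} {d : Fin n → (X ⟶ R)} (h : InD 1 d) (i j : Fin n) :
    d i * d j = 0 := by
  simpa [Fin.prod_univ_two] using h ![i, j]

theorem InD.of_mul_eq_zero {X : E} {n : ℕ} {d : Fin n → (X ⟶ R)}
    (h : ∀ i j, d i * d j = 0) : InD 1 d := by
  intro a
  rw [Fin.prod_univ_two]
  exact h _ _

/-- The exponents of total degree at most one: the constant and the `n` coordinates. -/
def degreeOneIndex (n : ℕ) : Option (Fin n) → MultiIndex n 1
  | none => ⟨fun _ => 0, by simp⟩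
  | some i => ⟨Pi.single i 1, by
      rw [Finset.sum_eq_single i]
      · simp
      · intro j _ hj
        simp [Pi.single_eq_of_ne hj]
      · simp⟩

theorem degreeOneIndex_bijective (n : ℕ) : Function.Bijective (degreeOneIndex n) := by
  constructor
  · rintro (_ | i) (_ | j) h
    · rfl
    · have := congrFun (congrArg Subtype.val h) j
      simp [degreeOneIndex] at this
    · have := congrFun (congrArg Subtype.val h) i
      simp [degreeOneIndex] at this
    · have := congrFun (congrArg Subtype.val h) i
      by_contra hij
      have hij' : i ≠ j := fun h => hij (congrArg some h)
      simp [degreeOneIndex, Pi.single_eq_of_ne hij'] at this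
  · rintro ⟨α, hα⟩
    by_cases h0 : ∀ i, α i = 0
    · exact ⟨none, Subtype.ext (funext fun i => (h0 i).symm)⟩
    · push Not at h0
      obtain ⟨i, hi⟩ := h0
      have hi1 : α i = 1 := Fin.eq_one_of_ne_zero _ hi
      refine ⟨some i, Subtype.ext (funext fun j => ?_)⟩
      by_cases hij : j = i
      · subst hij
        simp [degreeOneIndex, hi1]
      -- Total degree at most one leaves nothing for a second coordinate once `α i = 1`.
      · have h2 : (α i : ℕ) + (α j : ℕ) ≤ ∑ k, (α k : ℕ) := by
          rw [← Finset.sum_pair (f := fun k => (α k : ℕ)) (Ne.symm hij)]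
          exact Finset.sum_le_sum_of_subset (Finset.subset_univ _)
        have h3 : α j = 0 := by
          apply Fin.ext
          rw [hi1] at h2
          simp at h2 ⊢
          omega
        simp [degreeOneIndex, Pi.single_eq_of_ne hij, h3]

theorem sum_degreeOne {X Y : E} {n : ℕ} (c : MultiIndex n 1 → (X ⟶ W)) (y : Y ⟶ X)
    (d : Fin n → (Y ⟶ R)) :
    ∑ α : MultiIndex n 1, ((∏ i, d i ^ (α.1 i : ℕ)) ≫ s) * (y ≫ c α) =
      y ≫ c (degreeOneIndex n none) +
        ∑ i, push s Y (d i) * (y ≫ c (degreeOneIndex n (some i))) := by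
  rw [← (degreeOneIndex_bijective n).sum_comp, Fintype.sum_option]
  congr 1
  · simp only [degreeOneIndex, Fin.val_zero, pow_zero, Finset.prod_const_one]
    rw [← push_apply, map_one, one_mul]
  · refine Finset.sum_congr rfl fun i _ => ?_
    rw [← push_apply]
    congr 2
    rw [Finset.prod_eq_single i]
    · simp [degreeOneIndex]
    · intro j _ hj
      simp [degreeOneIndex, Pi.single_eq_of_ne hj]
    · simp

theorem IsKL.existsUnique_affine (hs : IsKL s) {n : ℕ} {X : E} (F : InfMap R X 1 n W) :
    ∃! c : Option (Fin n) → (X ⟶ W), ∀ (Y : E) (y : Y ⟶ X) (d : Fin n → (Y ⟶ R)) (h : InD 1 d),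
      F.app y d h = y ≫ c none + ∑ i, push s Y (d i) * (y ≫ c (some i)) := by
  obtain ⟨c, hc, huniq⟩ := hs 1 n X F
  refine ⟨fun o => c (degreeOneIndex n o), fun Y y d h => ?_, fun c' hc' => ?_⟩
  · rw [hc Y y d h, sum_degreeOne]
  · let e := Equiv.ofBijective _ (degreeOneIndex_bijective n)
    have he : ∀ o, e.symm (degreeOneIndex n o) = o := fun o => e.symm_apply_apply o
    have := huniq (fun α => c' (e.symm α)) (fun Y y d h => by
      rw [hc' Y y d h, sum_degreeOne, he]
      simp only [he])
    funext o
    have := congrFun this (degreeOneIndex n o)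
    rwa [he] at this

/-- The coefficients of the affine map given by the Kock–Lawvere property. -/
noncomputable def IsKL.coeff (hs : IsKL s) {n : ℕ} {X : E} (F : InfMap R X 1 n W) :
    Option (Fin n) → (X ⟶ W) :=
  (hs.existsUnique_affine F).choose

theorem IsKL.app_eq (hs : IsKL s) {n : ℕ} {X : E} (F : InfMap R X 1 n W) {Y : E} (y : Y ⟶ X)
    (d : Fin n → (Y ⟶ R)) (h : InD 1 d) :
    F.app y d h = y ≫ hs.coeff F none + ∑ i, push s Y (d i) * (y ≫ hs.coeff F (some i)) :=
  (hs.existsUnique_affine F).choose_spec.1 Y y d h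

theorem IsKL.coeff_unique (hs : IsKL s) {n : ℕ} {X : E} (F : InfMap R X 1 n W)
    (c : Option (Fin n) → (X ⟶ W))
    (hc : ∀ (Y : E) (y : Y ⟶ X) (d : Fin n → (Y ⟶ R)) (h : InD 1 d),
      F.app y d h = y ≫ c none + ∑ i, push s Y (d i) * (y ≫ c (some i))) :
    c = hs.coeff F :=
  (hs.existsUnique_affine F).choose_spec.2 c hc

/-- The map `a ↦ a w` on `D(1)` is zero, so `w` and `0` are both its linear coefficient; uniqueness
identifies them. -/
theorem IsKL.eq_zero_of_square_zero (hs : IsKL s) {X : E} (w : X ⟶ W)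
    (h : ∀ (Y : E) (y : Y ⟶ X) (a : Y ⟶ R), a * a = 0 → push s Y a * (y ≫ w) = 0) : w = 0 := by
  let F : InfMap R X 1 1 W := ⟨fun _ _ _ => 0, fun _ _ _ _ => comp_zero' _⟩
  have h1 := hs.coeff_unique F (fun o => o.elim 0 fun _ => w) (fun Y y d hd => by
    simp [F, h Y y (d 0) (hd.mul_eq_zero 0 0)])
  have h2 := hs.coeff_unique F (fun _ => 0) (fun Y y d hd => by
    simp [F])
  exact congrFun (h1.trans h2.symm) (some 0)

theorem IsKL.eq_zero_of_four_square_zero (hs : IsKL s) {X : E} (w : X ⟶ W)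
    (h : ∀ (Y : E) (y : Y ⟶ X) (a b c r : Y ⟶ R), a * a = 0 → b * b = 0 → c * c = 0 → r * r = 0 →
      push s Y (a * b * c * r) * (y ≫ w) = 0) : w = 0 := by
  have comp_sq : ∀ {Y Z : E} (f : Z ⟶ Y) {a : Y ⟶ R}, a * a = 0 → (f ≫ a) * (f ≫ a) = 0 := by
    intro Y Z f a ha
    rw [← comp_mul', ha, comp_zero']
  -- The scalars are cancelled one at a time, each living at a later stage than the one before.
  refine hs.eq_zero_of_square_zero w fun Y₁ y₁ a ha => ?_
  refine hs.eq_zero_of_square_zero _ fun Y₂ y₂ b hb => ?_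
  refine hs.eq_zero_of_square_zero _ fun Y₃ y₃ c hc => ?_
  refine hs.eq_zero_of_square_zero _ fun Y₄ y₄ r hr => ?_
  have := h Y₄ (y₄ ≫ y₃ ≫ y₂ ≫ y₁) (y₄ ≫ y₃ ≫ y₂ ≫ a) (y₄ ≫ y₃ ≫ b) (y₄ ≫ c) r
    (comp_sq _ (comp_sq _ (comp_sq _ ha))) (comp_sq _ (comp_sq _ hb)) (comp_sq _ hc) hr
  rw [← this]
  have e : ∀ a b c r : Y₄ ⟶ R, a * b * c * r = r * (c * (b * a)) := fun a b c r => by ring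
  rw [e]
  simp only [comp_mul', comp_push, map_mul, Category.assoc, mul_assoc]

end FirstOrder

/-! ### Neighbours in a chart: differences of coordinates lie in `D(m)`. -/

section Neighbours

variable {J : GrothendieckTopology E} {R : E} [CommRingObj R]

theorem DNbr.nbr {M X : E} {x y : X ⟶ M} (h : DNbr R x y) : Nbr J R x y :=
  ⟨⊤, J.top_mem X, fun _ f _ => h.comp f⟩

theorem InfMap.dNbr {n : ℕ} {M X Y : E} (F : InfMap R X 1 n M) (y : Y ⟶ X) (d : Fin n → (Y ⟶ R))
    (h : InD 1 d) : DNbr R (y ≫ F.app (𝟙 X) (fun _ => 0) InD.zero) (F.app y d h) := by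
  refine ⟨n, ⟨fun z e he => F.app (z ≫ y) e he, fun g z e he => ?_⟩, d, h, ?_, ?_⟩
  · simp [F.natural]
  · simp [F.natural]
  · simp

/-- Along a map from `D(n)` every coordinate is affine in `d` because `R` is KL. The differences are
therefore linear combinations of the `d j`, whose pairwise products vanish. -/
theorem inD_sub_of_dNbr (hKL : IsKL (𝟙 R)) {U M : E} {φ : U ⟶ M} (hφ : IsFormallyOpen J R φ)
    {m : ℕ} (coord : Fin m → (U ⟶ R)) {X : E} {u v : X ⟶ U} (h : DNbr R (u ≫ φ) (v ≫ φ)) :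
    InD 1 (fun i => v ≫ coord i - u ≫ coord i) := by
  have := hφ.mono
  obtain ⟨n, F, d, hd, h0, h1⟩ := h
  -- Each value of `F` is a neighbour of `F(0) = u`, so formal openness keeps it in `U`, where
  -- coordinates are defined.
  have lift : ∀ {Y : E} (y : Y ⟶ X) (e : Fin n → (Y ⟶ R)) (he : InD 1 e),
      ∃ w : Y ⟶ U, w ≫ φ = F.app y e he := fun y e he => by
    refine hφ.closed (y ≫ u) _ ?_
    have := F.dNbr y e he
    rw [h0] at this
    simpa using this.nbr
  choose w hw using @lift
  let G : Fin m → InfMap R X 1 n R := fun i =>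
    ⟨fun y e he => w y e he ≫ coord i, fun f y e he => by
      rw [← Category.assoc]
      congr 1
      rw [← cancel_mono φ, Category.assoc, hw, hw, F.natural]⟩
  have hu : w (𝟙 X) (fun _ => 0) InD.zero = u := by rw [← cancel_mono φ, hw, h0]
  have hv : w (𝟙 X) d hd = v := by rw [← cancel_mono φ, hw, h1]
  have key : ∀ i, v ≫ coord i - u ≫ coord i =
      ∑ j, d j * hKL.coeff (G i) (some j) := by
    intro i
    have e0 := hKL.app_eq (G i) (𝟙 X) (fun _ => 0) InD.zero
    have e1 := hKL.app_eq (G i) (𝟙 X) d hd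
    simp only [G, hu, hv, map_zero, zero_mul, Finset.sum_const_zero, add_zero, push_apply,
      Category.comp_id, Category.id_comp] at e0 e1
    rw [e0, e1, add_sub_cancel_left]
  refine InD.of_mul_eq_zero fun i j => ?_
  rw [key, key, Finset.sum_mul_sum]
  refine Finset.sum_eq_zero fun k _ => Finset.sum_eq_zero fun l _ => ?_
  rw [mul_mul_mul_comm, hd.mul_eq_zero, zero_mul]

theorem inD_sub_of_nbr [J.Subcanonical] (hKL : IsKL (𝟙 R)) {U M : E} {φ : U ⟶ M}
    (hφ : IsFormallyOpen J R φ) {m : ℕ} (coord : Fin m → (U ⟶ R)) {X : E} {u v : X ⟶ U}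
    (h : Nbr J R (u ≫ φ) (v ≫ φ)) : InD 1 (fun i => v ≫ coord i - u ≫ coord i) := by
  obtain ⟨S, hS, h⟩ := h
  refine InD.of_mul_eq_zero fun i j => hom_ext_of_cover hS fun Y f hf => ?_
  have h1 := h f hf
  rw [← Category.assoc, ← Category.assoc] at h1
  simpa [comp_mul', comp_sub', comp_zero'] using
    (inD_sub_of_dNbr hKL hφ coord h1).mul_eq_zero i j

/-- The translations `d ↦ u + d` themselves form the required map `D(m) → M`; naturality holds
because coordinates separate points. -/
theorem dNbr_of_translate {U M : E} (φ : U ⟶ M) {m : ℕ} (coord : Fin m → (U ⟶ R))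
    (hinj : ∀ {X : E} (u v : X ⟶ U), (∀ i, u ≫ coord i = v ≫ coord i) → u = v)
    (hadd : ∀ {X : E} (u : X ⟶ U) (d : Fin m → (X ⟶ R)), InD 1 d →
      ∃ v : X ⟶ U, ∀ i, v ≫ coord i = u ≫ coord i + d i)
    {X : E} {u v : X ⟶ U} (h : InD 1 (fun i => v ≫ coord i - u ≫ coord i)) :
    DNbr R (u ≫ φ) (v ≫ φ) := by
  choose t ht using @hadd
  refine ⟨m, ⟨fun y d hd => t (y ≫ u) d hd ≫ φ, fun f y d hd => ?_⟩, _, h, ?_, ?_⟩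
  · rw [← Category.assoc]
    congr 1
    refine hinj _ _ fun i => ?_
    simp [ht, comp_add']
  · dsimp only
    congr 1
    refine hinj _ _ fun i => ?_
    simp [ht]
  · dsimp only
    congr 1
    refine hinj _ _ fun i => ?_
    simp [ht]

end Neighbours

theorem GroupoidObj.homOne_homComp {C : Type u} [Category.{v} C] {M Y : C} {Φ : GroupoidObj M}
    {x y : Y ⟶ M} (a : Φ.Hom x y) : Φ.homComp (Φ.homOne x) a = a := by
  obtain ⟨a, rfl, rfl⟩ := a
  refine Subtype.ext ?_
  have := Φ.one_comp a
  simp only [GroupoidObj.homComp, GroupoidObj.homOne, Category.assoc]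
  exact this

/-- A chart of `M` and a formally open subobject of `M` over which `Φ` is trivial. -/
structure Patch (J : GrothendieckTopology E) (R : E) [CommRingObj R] {M : E}
    (Φ : GroupoidObj M) where
  V : E
  ψ : V ⟶ M
  openV : IsFormallyOpen J R ψ
  dim : ℕ
  coord : Fin dim → (V ⟶ R)
  coord_inj : ∀ {X : E} (u v : X ⟶ V), (∀ i, u ≫ coord i = v ≫ coord i) → u = v
  coord_add : ∀ {X : E} (u : X ⟶ V) (d : Fin dim → (X ⟶ R)), InD 1 d →
    ∃ v : X ⟶ V, ∀ i, v ≫ coord i = u ≫ coord i + d i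
  U : E
  φ : U ⟶ M
  openU : IsFormallyOpen J R φ
  G : E
  grpObj : GrpObj G
  matrix : MatrixEmbedding R G
  triv : Φ.Trivialization φ G

/-! ### Points of a patch and their infinitesimal translates. -/

namespace Patch

attribute [instance] Patch.grpObj MatrixEmbedding.ringObj MatrixEmbedding.isRingHom
  MatrixEmbedding.mono MatrixEmbedding.isMonHom

variable {J : GrothendieckTopology E} {R : E} [CommRingObj R] {M : E} {Φ : GroupoidObj M}

/-- An element of the intersection of the two open subobjects of a patch. -/
@[ext]
structure Pt (P : Patch J R Φ) (Y : E) where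
  v : Y ⟶ P.V
  u : Y ⟶ P.U
  comm : v ≫ P.ψ = u ≫ P.φ

namespace Pt

variable {P : Patch J R Φ} {X Y Z : E}

/-- The underlying element of `M`. -/
def pt (p : P.Pt Y) : Y ⟶ M := p.v ≫ P.ψ

/-- The coordinates of a point. -/
def coords (p : P.Pt Y) (i : Fin P.dim) : Y ⟶ R := p.v ≫ P.coord i

/-- Change of stage. -/
@[simps]
def restrict (f : Z ⟶ Y) (p : P.Pt Y) : P.Pt Z :=
  ⟨f ≫ p.v, f ≫ p.u, by simp [p.comm]⟩

theorem ext_pt {p q : P.Pt Y} (h : p.pt = q.pt) : p = q := by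
  have := P.openV.mono
  have := P.openU.mono
  ext
  · rwa [← cancel_mono P.ψ]
  · rw [← cancel_mono P.φ, ← p.comm, ← q.comm]
    exact h

theorem ext_coords {p q : P.Pt Y} (h : ∀ i, p.coords i = q.coords i) : p = q :=
  ext_pt (congrArg (· ≫ P.ψ) (P.coord_inj _ _ h))

theorem restrict_pt (f : Z ⟶ Y) (p : P.Pt Y) : (p.restrict f).pt = f ≫ p.pt := by
  simp [pt]

theorem nbr_restrict (f : Z ⟶ Y) {p q : P.Pt Y} (h : Nbr J R p.pt q.pt) :
    Nbr J R (p.restrict f).pt (q.restrict f).pt := by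
  rw [restrict_pt, restrict_pt]
  exact h.comp f

theorem restrict_coords (f : Z ⟶ Y) (p : P.Pt Y) (i : Fin P.dim) :
    (p.restrict f).coords i = f ≫ p.coords i := by
  simp [coords]

theorem restrict_id (p : P.Pt Y) : p.restrict (𝟙 Y) = p := by
  ext <;> simp

theorem restrict_restrict (f : Z ⟶ Y) (g : X ⟶ Z) (p : P.Pt Y) :
    (p.restrict f).restrict g = p.restrict (g ≫ f) := by
  ext <;> simp

/-- Since both open sets are formally open, a path that starts in the patch never leaves it. -/
theorem exists_of_nbr (p : P.Pt Y) (y : Y ⟶ M) (h : Nbr J R p.pt y) : ∃ q : P.Pt Y, q.pt = y := by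
  obtain ⟨v, hv⟩ := P.openV.closed p.v y h
  obtain ⟨u, hu⟩ := P.openU.closed p.u y (by rwa [← p.comm])
  exact ⟨⟨v, u, hv.trans hu.symm⟩, hv⟩

theorem nbr_of_inD {p q : P.Pt Y} (h : InD 1 (fun i => q.coords i - p.coords i)) :
    Nbr J R p.pt q.pt :=
  (dNbr_of_translate P.ψ P.coord P.coord_inj P.coord_add h).nbr

theorem inD_of_nbr [J.Subcanonical] (hKL : IsKL (𝟙 R)) {p q : P.Pt Y} (h : Nbr J R p.pt q.pt) :
    InD 1 (fun i => q.coords i - p.coords i) :=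
  inD_sub_of_nbr hKL P.openV P.coord h

/-- The chart only provides a translate in `V`; being a neighbour of `p`, it lies in `U` as well. -/
theorem exists_add (p : P.Pt Y) (d : Fin P.dim → (Y ⟶ R)) (hd : InD 1 d) :
    ∃ q : P.Pt Y, ∀ i, q.coords i = p.coords i + d i := by
  obtain ⟨v, hv⟩ := P.coord_add p.v d hd
  have h : InD 1 (fun i => v ≫ P.coord i - p.v ≫ P.coord i) := by
    simpa [hv] using hd
  have h' : Nbr J R p.pt (v ≫ P.ψ) :=
    (dNbr_of_translate P.ψ P.coord P.coord_inj P.coord_add h).nbr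
  obtain ⟨q, hq⟩ := p.exists_of_nbr _ h'
  have := P.openV.mono
  have hv' : q.v = v := by rw [← cancel_mono P.ψ]; exact hq
  exact ⟨q, fun i => by rw [coords, hv', hv]; rfl⟩

/-- The translate of a point by an infinitesimal vector. -/
noncomputable def add (p : P.Pt Y) (d : Fin P.dim → (Y ⟶ R)) (hd : InD 1 d) : P.Pt Y :=
  (p.exists_add d hd).choose

theorem add_coords (p : P.Pt Y) (d : Fin P.dim → (Y ⟶ R)) (hd : InD 1 d) (i : Fin P.dim) :
    (p.add d hd).coords i = p.coords i + d i :=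
  (p.exists_add d hd).choose_spec i

theorem nbr_add (p : P.Pt Y) (d : Fin P.dim → (Y ⟶ R)) (hd : InD 1 d) :
    Nbr J R p.pt (p.add d hd).pt :=
  nbr_of_inD (by simpa [add_coords] using hd)

theorem add_zero (p : P.Pt Y) : p.add (fun _ => 0) InD.zero = p :=
  ext_coords fun i => by simp [add_coords]

theorem add_restrict (f : Z ⟶ Y) (p : P.Pt Y) (d : Fin P.dim → (Y ⟶ R)) (hd : InD 1 d) :
    (p.add d hd).restrict f = (p.restrict f).add (fun i => f ≫ d i) (hd.comp f) :=
  ext_coords fun i => by simp [add_coords, restrict_coords, comp_add']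

theorem add_add (p : P.Pt Y) (d e : Fin P.dim → (Y ⟶ R)) (hd : InD 1 d) (he : InD 1 e)
    (hde : InD 1 (fun i => d i + e i)) :
    (p.add d hd).add e he = p.add (fun i => d i + e i) hde :=
  ext_coords fun i => by simp [add_coords, add_assoc]

end Pt

/-! ### Arrows and connections as matrices. -/

variable (P : Patch J R Φ) {X Y Z : E}

/-- An arrow of `Φ` between two points, as an arrow between elements of `U`. -/
def overU {p q : P.Pt Y} (a : Φ.Hom p.pt q.pt) : Φ.Hom (p.u ≫ P.φ) (q.u ≫ P.φ) :=
  ⟨a.1, a.2.1.trans p.comm, a.2.2.trans q.comm⟩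

theorem overU_injective {p q : P.Pt Y} :
    Function.Injective (P.overU : Φ.Hom p.pt q.pt → Φ.Hom (p.u ≫ P.φ) (q.u ≫ P.φ)) :=
  fun _ _ h => Subtype.ext (congrArg (fun c => c.1) h)

/-- The matrix of an arrow of `Φ` in the trivialization. -/
def hol (p q : P.Pt Y) (a : Φ.Hom p.pt q.pt) : Y ⟶ P.matrix.W :=
  P.triv.equiv p.u q.u (P.overU a) ≫ P.matrix.emb

theorem hol_injective (p q : P.Pt Y) {a b : Φ.Hom p.pt q.pt} (h : P.hol p q a = P.hol p q b) :
    a = b := by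
  rw [hol, hol, cancel_mono] at h
  exact P.overU_injective ((P.triv.equiv p.u q.u).injective h)

theorem hol_comp (p q r : P.Pt Y) (a : Φ.Hom p.pt q.pt) (b : Φ.Hom q.pt r.pt) :
    P.hol p r (Φ.homComp a b) = P.hol p q a * P.hol q r b := by
  have h : P.overU (Φ.homComp a b) = Φ.homComp (P.overU a) (P.overU b) := rfl
  rw [hol, hol, hol, ← MonObj.mul_comp, ← P.triv.map_comp, h]

/-- A trivialization is only assumed multiplicative; the unit goes to an idempotent of a group,
hence to `1`. -/
theorem hol_one (p : P.Pt Y) : P.hol p p (Φ.homOne p.pt) = 1 := by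
  have h : Φ.homComp (P.overU (Φ.homOne p.pt)) (P.overU (Φ.homOne p.pt)) =
      P.overU (Φ.homOne p.pt) :=
    congrArg P.overU (GroupoidObj.homOne_homComp (Φ.homOne p.pt))
  have h1 := P.triv.map_comp p.u p.u p.u (P.overU (Φ.homOne p.pt)) (P.overU (Φ.homOne p.pt))
  rw [h, left_eq_mul] at h1
  rw [hol, h1, MonObj.one_comp]

theorem hol_restrict (f : Z ⟶ Y) (p q : P.Pt Y) (a : Φ.Hom p.pt q.pt)
    (b : Φ.Hom (p.restrict f).pt (q.restrict f).pt) (h : b.1 = f ≫ a.1) :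
    P.hol (p.restrict f) (q.restrict f) b = f ≫ P.hol p q a := by
  rw [hol, hol, ← Category.assoc]
  congr 1
  exact P.triv.natural f p.u q.u _ _ h

variable (conn : Connection J R Φ)

/-- The matrix of `∇(p, q)`. -/
def connMatrix (p q : P.Pt Y) (h : Nbr J R p.pt q.pt) : Y ⟶ P.matrix.W :=
  P.hol p q (conn.val p.pt q.pt h)

theorem connMatrix_self (p : P.Pt Y) (h : Nbr J R p.pt p.pt) : P.connMatrix conn p p h = 1 := by
  rw [Patch.connMatrix, conn.val_self, hol_one]

theorem val_congr {x x' y y' : Y ⟶ M} (hx : x = x') (hy : y = y') (h : Nbr J R x y)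
    (h' : Nbr J R x' y') : (conn.val x y h).1 = (conn.val x' y' h').1 := by
  subst hx hy
  rfl

theorem connMatrix_restrict (f : Z ⟶ Y) (p q : P.Pt Y) (h : Nbr J R p.pt q.pt)
    (h' : Nbr J R (p.restrict f).pt (q.restrict f).pt) :
    P.connMatrix conn (p.restrict f) (q.restrict f) h' = f ≫ P.connMatrix conn p q h := by
  refine P.hol_restrict f p q _ _ ?_
  rw [← conn.natural]
  exact val_congr conn (p.restrict_pt f) (q.restrict_pt f) _ _

theorem connMatrix_mul {conn : Connection J R Φ} (hflat : conn.IsFlat) (p q r : P.Pt Y)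
    (hpq : Nbr J R p.pt q.pt) (hqr : Nbr J R q.pt r.pt) (hpr : Nbr J R p.pt r.pt) :
    P.connMatrix conn p q hpq * P.connMatrix conn q r hqr = P.connMatrix conn p r hpr := by
  rw [Patch.connMatrix, Patch.connMatrix, ← hol_comp, hflat]
  rfl

/-! ### Functions with values in `W` and their covariant derivatives. -/

/-- A `W`-valued function on the part of `M` covered by the patch, defined over the stage `X`. -/
@[ext]
structure Fn (X : E) where
  app : ∀ {Y : E} (_ : Y ⟶ X) (_ : P.Pt Y), (Y ⟶ P.matrix.W)
  natural : ∀ {Y Z : E} (g : Z ⟶ Y) (f : Y ⟶ X) (p : P.Pt Y),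
    g ≫ app f p = app (g ≫ f) (p.restrict g)

namespace Fn

variable {P}

instance : Zero (P.Fn X) := ⟨⟨fun _ _ => 0, fun _ _ _ => comp_zero' _⟩⟩
instance : One (P.Fn X) := ⟨⟨fun _ _ => 1, fun _ _ _ => comp_one' _⟩⟩
instance : Add (P.Fn X) :=
  ⟨fun a b => ⟨fun f p => a.app f p + b.app f p, fun g f p => by
    rw [comp_add', a.natural, b.natural]⟩⟩
instance : Neg (P.Fn X) :=
  ⟨fun a => ⟨fun f p => -a.app f p, fun g f p => by rw [comp_neg', a.natural]⟩⟩
instance : SMul (X ⟶ R) (P.Fn X) :=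
  ⟨fun r a => ⟨fun {Y} f p => push P.matrix.scalar Y (f ≫ r) * a.app f p, fun g f p => by
    rw [comp_mul', comp_push, a.natural, Category.assoc]⟩⟩

theorem zero_app (f : Y ⟶ X) (p : P.Pt Y) : (0 : P.Fn X).app f p = 0 := rfl
theorem one_app (f : Y ⟶ X) (p : P.Pt Y) : (1 : P.Fn X).app f p = 1 := rfl
theorem add_app (a b : P.Fn X) (f : Y ⟶ X) (p : P.Pt Y) :
    (a + b).app f p = a.app f p + b.app f p := rfl
theorem neg_app (a : P.Fn X) (f : Y ⟶ X) (p : P.Pt Y) : (-a).app f p = -a.app f p := rfl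
theorem smul_app (r : X ⟶ R) (a : P.Fn X) (f : Y ⟶ X) (p : P.Pt Y) :
    (r • a).app f p = push P.matrix.scalar Y (f ≫ r) * a.app f p := rfl

theorem ext_app {a b : P.Fn X} (h : ∀ (Y : E) (f : Y ⟶ X) (p : P.Pt Y), a.app f p = b.app f p) :
    a = b := by
  ext Y f p
  exact h Y f p

instance : AddCommGroup (P.Fn X) where
  add_assoc a b c := ext_app fun Y f p => by simp only [add_app, add_assoc]
  zero_add a := ext_app fun Y f p => by simp only [add_app, zero_app, zero_add]
  add_zero a := ext_app fun Y f p => by simp only [add_app, zero_app, add_zero]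
  add_comm a b := ext_app fun Y f p => by simp only [add_app, add_comm]
  neg_add_cancel a := ext_app fun Y f p => by
    simp only [add_app, neg_app, zero_app, neg_add_cancel]
  nsmul := nsmulRec
  zsmul := zsmulRec

instance : Module (X ⟶ R) (P.Fn X) where
  one_smul a := ext_app fun Y f p => by simp only [smul_app, comp_one', map_one, one_mul]
  mul_smul r t a := ext_app fun Y f p => by simp only [smul_app, comp_mul', map_mul, mul_assoc]
  smul_zero r := ext_app fun Y f p => by simp only [smul_app, zero_app, mul_zero]
  zero_smul a := ext_app fun Y f p => by
    simp only [smul_app, zero_app, comp_zero', map_zero, zero_mul]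
  smul_add r a b := ext_app fun Y f p => by simp only [smul_app, add_app, mul_add]
  add_smul r t a := ext_app fun Y f p => by
    simp only [smul_app, add_app, comp_add', map_add, add_mul]

/-- Evaluation of functions at a point. -/
def eval (f : Y ⟶ X) (p : P.Pt Y) : P.Fn X →+ (Y ⟶ P.matrix.W) where
  toFun a := a.app f p
  map_zero' := rfl
  map_add' _ _ := rfl

theorem sum_app {I : Type*} (s : Finset I) (a : I → P.Fn X) (f : Y ⟶ X) (p : P.Pt Y) :
    (∑ i ∈ s, a i).app f p = ∑ i ∈ s, (a i).app f p :=
  map_sum (eval f p) a s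

variable {conn : Connection J R Φ}

/-- The map `d ↦ ∇(p, p + d) a(p + d)`. -/
noncomputable def translate (conn : Connection J R Φ) (a : P.Fn X) (f : Y ⟶ X) (p : P.Pt Y) :
    InfMap R Y 1 P.dim P.matrix.W where
  app y d hd := P.connMatrix conn (p.restrict y) _ ((p.restrict y).nbr_add d hd) *
    a.app (y ≫ f) ((p.restrict y).add d hd)
  natural g y d hd := by
    rw [comp_mul', a.natural, ← P.connMatrix_restrict conn g (p.restrict y) _ _
      (Pt.nbr_restrict g ((p.restrict y).nbr_add d hd))]
    simp only [Pt.add_restrict, Pt.restrict_restrict, Category.assoc]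

theorem translate_app_congr (a : P.Fn X) (f : Y ⟶ X) (p : P.Pt Y) (y : Z ⟶ Y)
    (d : Fin P.dim → (Z ⟶ R)) (hd : InD 1 d) :
    (a.translate conn f p).app y d hd =
      (a.translate conn (y ≫ f) (p.restrict y)).app (𝟙 Z) d hd := by
  simp only [translate, Pt.restrict_id, Category.id_comp]

/-- Restricted coefficients still represent the restricted map, so uniqueness makes them natural.
This makes the derivative of a function a function again. -/
theorem coeff_natural (a : P.Fn X) (f : Y ⟶ X) (p : P.Pt Y) (y : Z ⟶ Y) :
    (fun o => y ≫ P.matrix.isKL.coeff (a.translate conn f p) o) =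
      P.matrix.isKL.coeff (a.translate conn (y ≫ f) (p.restrict y)) := by
  refine P.matrix.isKL.coeff_unique _ _ fun Z' z d hd => ?_
  have := P.matrix.isKL.app_eq (a.translate conn f p) (z ≫ y) d hd
  rw [translate_app_congr, Pt.restrict_restrict, ← Category.assoc, ← translate_app_congr, this]
  simp only [Category.assoc]

theorem coeff_none (a : P.Fn X) (f : Y ⟶ X) (p : P.Pt Y) :
    P.matrix.isKL.coeff (a.translate conn f p) none = a.app f p := by
  have := P.matrix.isKL.app_eq (a.translate conn f p) (𝟙 Y) (fun _ => 0) InD.zero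
  simp only [map_zero, zero_mul, Finset.sum_const_zero, add_zero, Category.id_comp] at this
  rw [← this]
  simp only [translate, Pt.restrict_id, Category.id_comp, Pt.add_zero, connMatrix_self, one_mul]

end Fn

/-- The covariant derivative in the direction of the `i`-th coordinate. -/
noncomputable def deriv (X : E) (i : Fin P.dim) : Module.End (X ⟶ R) (P.Fn X) where
  toFun a :=
    ⟨fun f p => P.matrix.isKL.coeff (a.translate conn f p) (some i), fun g f p =>
      congrFun (Fn.coeff_natural a f p g) (some i)⟩
  map_add' a b := Fn.ext_app fun Y f p => by
    rw [Fn.add_app]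
    refine (congrFun (P.matrix.isKL.coeff_unique _ (fun o =>
      P.matrix.isKL.coeff (a.translate conn f p) o +
        P.matrix.isKL.coeff (b.translate conn f p) o) fun Z y d hd => ?_) (some i)).symm
    simp only [comp_add', mul_add, Finset.sum_add_distrib]
    rw [add_add_add_comm, ← P.matrix.isKL.app_eq _ y d hd, ← P.matrix.isKL.app_eq _ y d hd]
    simp only [Fn.translate, Fn.add_app, mul_add]
  map_smul' r a := Fn.ext_app fun Y f p => by
    rw [RingHom.id_apply, Fn.smul_app]
    refine (congrFun (P.matrix.isKL.coeff_unique _ (fun o =>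
      push P.matrix.scalar Y (f ≫ r) * P.matrix.isKL.coeff (a.translate conn f p) o)
        fun Z y d hd => ?_) (some i)).symm
    -- Central scalars move past the connection matrix. As `r` does not vary with the point, no
    -- Leibniz term appears.
    have hcomm : ∀ (t : Z ⟶ R) (w : Z ⟶ P.matrix.W),
        push P.matrix.scalar Z t * w = w * push P.matrix.scalar Z t := P.matrix.central
    have h := P.matrix.isKL.app_eq (a.translate conn f p) y d hd
    have h2 : ((r • a).translate conn f p).app y d hd =
        push P.matrix.scalar Z (y ≫ f ≫ r) * (a.translate conn f p).app y d hd := by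
      simp only [Fn.translate, Fn.smul_app, Category.assoc]
      rw [← mul_assoc, ← hcomm, mul_assoc]
    rw [h2, h, mul_add, Finset.mul_sum]
    simp only [comp_mul', comp_push]
    congr 1
    refine Finset.sum_congr rfl fun j _ => ?_
    rw [← mul_assoc, ← mul_assoc, hcomm (d j)]

theorem translate_eq (a : P.Fn X) (f : Y ⟶ X) (p : P.Pt Y) (d : Fin P.dim → (Y ⟶ R))
    (hd : InD 1 d) (h : Nbr J R p.pt (p.add d hd).pt) :
    P.connMatrix conn p (p.add d hd) h * a.app f (p.add d hd) =
      a.app f p + ∑ i, push P.matrix.scalar Y (d i) * (P.deriv conn X i a).app f p := by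
  have := P.matrix.isKL.app_eq (a.translate conn f p) (𝟙 Y) d hd
  simp only [Category.id_comp, Fn.coeff_none] at this
  refine Eq.trans ?_ this
  simp only [Fn.translate, Pt.restrict_id, Category.id_comp]

/-- Flatness gives two expansions of `∇(p, p + d + e) a(p + d + e)`: directly, and through `p + d`.
Terms of order zero and one agree, leaving the mixed second-order sum. -/
theorem sum_deriv_deriv_eq_zero {conn : Connection J R Φ} (hflat : conn.IsFlat) (a : P.Fn X)
    (f : Y ⟶ X) (p : P.Pt Y) (d e : Fin P.dim → (Y ⟶ R)) (hd : InD 1 d) (he : InD 1 e)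
    (hde : InD 1 (fun i => d i + e i)) :
    ∑ j, ∑ i, push P.matrix.scalar Y (e j * d i) *
      (P.deriv conn X i (P.deriv conn X j a)).app f p = 0 := by
  have hcomm : ∀ (t : Y ⟶ R) (w : Y ⟶ P.matrix.W),
    push P.matrix.scalar Y t * w = w * push P.matrix.scalar Y t := P.matrix.central
  have h1 := P.translate_eq conn a f (p.add d hd) e he (Pt.nbr_add _ _ _)
  have h2 := P.translate_eq conn a f p _ hde (Pt.nbr_add _ _ _)
  have h3 := congrArg (P.connMatrix conn p (p.add d hd) (Pt.nbr_add _ _ _) * ·) h1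
  have h4 : Nbr J R p.pt ((p.add d hd).add e he).pt := by
    rw [Pt.add_add p d e hd he hde]
    exact Pt.nbr_add _ _ _
  rw [← mul_assoc, P.connMatrix_mul hflat _ _ _ _ _ h4, mul_add, P.translate_eq, Finset.mul_sum] at h3
  simp only [Pt.add_add p d e hd he hde] at h3
  rw [h2] at h3
  have h5 : ∀ j, P.connMatrix conn p (p.add d hd) (Pt.nbr_add _ _ _) *
      (push P.matrix.scalar Y (e j) * (P.deriv conn X j a).app f (p.add d hd)) =
      push P.matrix.scalar Y (e j) * (P.deriv conn X j a).app f p +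
      ∑ i, push P.matrix.scalar Y (e j * d i) *
        (P.deriv conn X i (P.deriv conn X j a)).app f p := fun j => by
    rw [← mul_assoc, ← hcomm, mul_assoc, P.translate_eq, mul_add, Finset.mul_sum]
    simp only [map_mul, mul_assoc]
  simp only [h5, map_add, add_mul, Finset.sum_add_distrib] at h3
  rw [← add_assoc, ← add_assoc] at h3
  exact (left_eq_add.mp h3)

/-- Membership of `d + e` in `D` forces `dₖ eₗ + eₖ dₗ = 0`, so only the antisymmetric part of the
second derivatives is tested. Vectors built from four square-zero scalars isolate the commutator
with coefficient `a₁ b c r`, which is then cancelled. -/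
theorem deriv_commute {conn : Connection J R Φ} (hflat : conn.IsFlat) (i j : Fin P.dim) :
    Commute (P.deriv conn X i) (P.deriv conn X j) := by
  by_cases hij : i = j
  · rw [hij]
  refine LinearMap.ext fun a => Fn.ext_app fun Y f p => ?_
  rw [← sub_eq_zero]
  refine P.matrix.isKL.eq_zero_of_four_square_zero _ fun Z y a₁ b c r ha hb hc hr => ?_
  have hji : j ≠ i := Ne.symm hij
  -- The vectors are `d = a₁ (b, c)` and `e = r (-b, c)` in the plane of coordinates `i`, `j`: the
  -- sign makes the symmetric products vanish while `dᵢ eⱼ` survives.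
  let x : Fin P.dim → (Z ⟶ R) := fun k => if k = i then b else if k = j then c else 0
  let z : Fin P.dim → (Z ⟶ R) := fun k => if k = i then -b else if k = j then c else 0
  have hxz : ∀ k l, x k * z l + z k * x l = 0 := fun k l => by
    simp only [x, z]
    split_ifs <;> first | ring1 | linear_combination (-2) * hb | linear_combination 2 * hc
  have hd : InD 1 (fun k => a₁ * x k) := InD.of_mul_eq_zero fun k l => by
    linear_combination x k * x l * ha
  have he : InD 1 (fun k => r * z k) := InD.of_mul_eq_zero fun k l => by
    linear_combination z k * z l * hr
  have hde : InD 1 (fun k => a₁ * x k + r * z k) := InD.of_mul_eq_zero fun k l => by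
    linear_combination x k * x l * ha + z k * z l * hr + a₁ * r * hxz k l
  have key := P.sum_deriv_deriv_eq_zero hflat a (y ≫ f) (p.restrict y) _ _ hd he hde
  rw [Fintype.sum_eq_add i j hij, Fintype.sum_eq_add i j hij, Fintype.sum_eq_add i j hij] at key
  · have e1 : r * z i * (a₁ * x i) = 0 := by
      simp only [x, z, if_true]; linear_combination (-a₁ * r) * hb
    have e2 : r * z j * (a₁ * x j) = 0 := by
      simp only [x, z, if_true, if_neg hji]; linear_combination (a₁ * r) * hc
    have e3 : r * z i * (a₁ * x j) = -(a₁ * b * c * r) := by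
      simp only [x, z, if_true, if_neg hji]; ring
    have e4 : r * z j * (a₁ * x i) = a₁ * b * c * r := by
      simp only [x, z, if_true, if_neg hji]; ring
    rw [e1, e2, e3, e4] at key
    simp only [map_zero, zero_mul, zero_add, add_zero, map_neg, neg_mul] at key
    rw [comp_sub', mul_sub, Fn.natural, Fn.natural, Module.End.mul_apply, Module.End.mul_apply,
      sub_eq_neg_add]
    exact key
  all_goals
    intro k hk
    simp [x, z, hk.1, hk.2]

end Patch

/-! ### Parallel transport as an exponential. -/

/-- A ring in which positive integers are invertible receives a map from `ℚ`. -/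
noncomputable def ratHom {B : Type*} [CommRing B] (h : ∀ n : ℕ, n ≠ 0 → IsUnit (n : B)) :
    ℚ →+* B :=
  IsLocalization.lift (M := nonZeroDivisors ℤ) (g := Int.castRingHom B) fun y => by
    obtain ⟨n, hn⟩ := (y : ℤ).eq_nat_or_neg
    have hy : (y : ℤ) ≠ 0 := nonZeroDivisors.ne_zero y.2
    have hn0 : n ≠ 0 := by
      rintro rfl
      simp at hn
    rcases hn with hn | hn
    · simpa [hn] using h n hn0
    · simpa [hn] using (h n hn0).neg

theorem exp_eq_one_add {A : Type*} [Ring A] [Module ℚ A] {a : A} (h : a * a = 0) :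
    IsNilpotent.exp a = 1 + a := by
  rw [IsNilpotent.exp_eq_sum (k := 2) (by rw [pow_two, h])]
  simp [Finset.sum_range_succ]

namespace Patch

variable {J : GrothendieckTopology E} {R : E} [CommRingObj R] {M : E} {Φ : GroupoidObj M}
  (P : Patch J R Φ) {X Y : E} (conn : Connection J R Φ)

/-- The covariant derivative in the direction of a vector. -/
noncomputable def dirDeriv (s : Fin P.dim → (X ⟶ R)) : Module.End (X ⟶ R) (P.Fn X) :=
  ∑ i, s i • P.deriv conn X i

theorem dirDeriv_add (s t : Fin P.dim → (X ⟶ R)) :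
    P.dirDeriv conn (s + t) = P.dirDeriv conn s + P.dirDeriv conn t := by
  simp [dirDeriv, add_smul, Finset.sum_add_distrib]

variable {conn}

theorem dirDeriv_commute (hflat : conn.IsFlat) (s t : Fin P.dim → (X ⟶ R)) :
    Commute (P.dirDeriv conn s) (P.dirDeriv conn t) :=
  Commute.sum_left _ _ _ fun i _ => Commute.sum_right _ _ _ fun j _ =>
    ((P.deriv_commute hflat i j).smul_left _).smul_right _

/-- By linearity over the stage scalars, the square has coefficients `dᵢ dⱼ = 0`. -/
theorem dirDeriv_mul_self {d : Fin P.dim → (X ⟶ R)} (hd : InD 1 d) :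
    P.dirDeriv conn d * P.dirDeriv conn d = 0 := by
  rw [dirDeriv, Finset.sum_mul_sum]
  refine Finset.sum_eq_zero fun i _ => Finset.sum_eq_zero fun j _ => ?_
  rw [smul_mul_smul_comm, hd.mul_eq_zero, zero_smul]

theorem one_add_dirDeriv_app (a : P.Fn X) {p q : P.Pt X} {d : Fin P.dim → (X ⟶ R)}
    (hd : InD 1 d) (hq : ∀ i, q.coords i = p.coords i + d i) (h : Nbr J R p.pt q.pt) :
    ((1 + P.dirDeriv conn d) a).app (𝟙 X) p = P.connMatrix conn p q h * a.app (𝟙 X) q := by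
  obtain rfl : q = p.add d hd := Pt.ext_coords fun i => by rw [hq, Pt.add_coords]
  rw [P.translate_eq conn a, LinearMap.add_apply, Module.End.one_apply, Fn.add_app, dirDeriv,
    LinearMap.sum_apply, Fn.sum_app]
  simp only [LinearMap.smul_apply, Fn.smul_app, Category.id_comp]

/-- Induction on the length: the hypothesis is applied to the function `(1 + D) a`, with `D` the
derivative along the last step, hence the quantification over all `a`. Nilpotency is carried along
because `exp` is multiplicative only on commuting nilpotents, and `q - p` need not lie in `D(m)`.
The arrow `t` absorbs the fact that `p.pt` and `x.pt 0` are equal only propositionally. -/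
theorem exp_dirDeriv_app [J.Subcanonical] (hKL : IsKL (𝟙 R)) (hflat : conn.IsFlat)
    [Module ℚ (Module.End (X ⟶ R) (P.Fn X))] :
    ∀ {n : ℕ} (x : NPath J R M X n) (p : P.Pt X), p.pt = x.pt 0 →
      ∃ q : P.Pt X, q.pt = x.pt (Fin.last n) ∧
        IsNilpotent (P.dirDeriv conn fun i => q.coords i - p.coords i) ∧
        ∀ (t : Φ.Hom p.pt q.pt), t.1 = (conn.transport x).1 → ∀ a : P.Fn X,
          (IsNilpotent.exp (P.dirDeriv conn fun i => q.coords i - p.coords i) a).app (𝟙 X) p =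
            P.hol p q t * a.app (𝟙 X) q
  | 0, x, p, hp => by
    have h0 : (P.dirDeriv conn fun i => p.coords i - p.coords i) = 0 := by simp [dirDeriv]
    refine ⟨p, hp, by simp only [h0, IsNilpotent.zero], fun t ht a => ?_⟩
    have ht' : t = Φ.homOne p.pt := Subtype.ext (by
      rw [ht, hp]
      rfl)
    rw [h0, IsNilpotent.exp_zero, ht', hol_one, one_mul, Module.End.one_apply]
  | n + 1, x, p, hp => by
    obtain ⟨q, hq, hnil, ih⟩ := exp_dirDeriv_app hKL hflat x.init p hp
    have hx := x.adj (Fin.last n)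
    obtain ⟨r, hr⟩ := q.exists_of_nbr (x.pt (Fin.last n).succ) (by rw [hq]; exact hx)
    have hqr : Nbr J R q.pt r.pt := by rw [hq, hr]; exact hx
    have hd := Pt.inD_of_nbr hKL hqr
    have hsum : (P.dirDeriv conn fun i => r.coords i - p.coords i) =
        (P.dirDeriv conn fun i => q.coords i - p.coords i) +
          P.dirDeriv conn fun i => r.coords i - q.coords i := by
      rw [← dirDeriv_add]
      congr 1
      funext i
      simp
    have hsq := P.dirDeriv_mul_self (conn := conn) hd
    have hnil' : IsNilpotent (P.dirDeriv conn fun i => r.coords i - q.coords i) :=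
      ⟨2, by rw [pow_two, hsq]⟩
    have hcomm := P.dirDeriv_commute hflat (fun i => q.coords i - p.coords i)
      (fun i => r.coords i - q.coords i)
    refine ⟨r, hr, ?_, fun t ht a => ?_⟩
    · rw [hsum]
      exact hcomm.isNilpotent_add hnil hnil'
    · let t₀ : Φ.Hom p.pt q.pt := ⟨(conn.transport x.init).1,
        (conn.transport x.init).2.1.trans hp.symm, (conn.transport x.init).2.2.trans hq.symm⟩
      have ht' : t = Φ.homComp t₀ (conn.val q.pt r.pt hqr) := by
        refine Subtype.ext (ht.trans ?_)
        have e := val_congr conn hq hr hqr hx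
        simp only [Connection.transport, GroupoidObj.homComp, t₀]
        congr 1
        exact e.symm
      rw [hsum, IsNilpotent.exp_add_of_commute hcomm hnil hnil', Module.End.mul_apply,
        ih t₀ rfl, exp_eq_one_add hsq, P.one_add_dirDeriv_app a hd (fun i => by simp) hqr, ht', hol_comp, mul_assoc]
      rfl

theorem transport_eq [J.Subcanonical] (hQ : ContainsRationals R) (hKL : IsKL (𝟙 R))
    (hflat : conn.IsFlat) {n : ℕ} (x y : NPath J R M X n) (h0 : x.pt 0 = y.pt 0)
    (hn : x.pt (Fin.last n) = y.pt (Fin.last n)) (p : P.Pt X) (hp : p.pt = x.pt 0) :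
    (conn.transport x).1 = (conn.transport y).1 := by
  let _ : Module ℚ (Module.End (X ⟶ R) (P.Fn X)) := Module.compHom _ (ratHom (hQ X))
  obtain ⟨q, hq, -, hx⟩ := P.exp_dirDeriv_app hKL hflat x p hp
  obtain ⟨q', hq', -, hy⟩ := P.exp_dirDeriv_app hKL hflat y p (hp.trans h0)
  obtain rfl : q = q' := Pt.ext_pt (hq.trans (hn.trans hq'.symm))
  let s : Φ.Hom p.pt q.pt := ⟨(conn.transport x).1,
    (conn.transport x).2.1.trans hp.symm, (conn.transport x).2.2.trans hq.symm⟩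
  let t : Φ.Hom p.pt q.pt := ⟨(conn.transport y).1,
    (conn.transport y).2.1.trans (hp.trans h0).symm, (conn.transport y).2.2.trans hq'.symm⟩
  -- On the constant function `1` the same exponential gives the matrices of both transports.
  have h := (hx s rfl 1).symm.trans (hy t rfl 1)
  rw [Fn.one_app, mul_one, mul_one] at h
  exact congrArg (fun c => c.1) (P.hol_injective p q h)

end Patch

/-- Charts and trivializing open sets come from unrelated covers; intersecting the two sieves
provides both at once. -/
theorem exists_patch {J : GrothendieckTopology E} {R : E} [CommRingObj R] {M : E}
    (hM : IsFormalManifold J R M) {Φ : GroupoidObj M} (hΦ : Φ.IsLocallyTrivial J R) {X : E}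
    (x : X ⟶ M) :
    ∃ S ∈ J X, ∀ ⦃Y : E⦄ (f : Y ⟶ X), S f → ∃ (P : Patch J R Φ) (p : P.Pt Y), p.pt = f ≫ x := by
  obtain ⟨S, hS, hchart⟩ := hM x
  obtain ⟨T, hT, htriv⟩ := hΦ x
  refine ⟨S ⊓ T, J.intersection_covering hS hT, fun Y f hf => ?_⟩
  obtain ⟨V, ψ, ⟨hψ, m, coord, hinj, hadd⟩, w, hw⟩ := hchart f hf.1
  obtain ⟨U, φ, hφ, ⟨t, ht⟩, G, hG, ⟨A⟩, ⟨B⟩⟩ := htriv f hf.2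
  exact ⟨⟨V, ψ, hψ, m, coord, hinj, hadd, U, φ, hφ, G, hG, A, B⟩, ⟨w, t, hw.trans ht.symm⟩, hw⟩

end SDG

theorem proposition2p1 {E : Type u} [Category.{v} E] [CartesianMonoidalCategory E]
    [BraidedCategory E] (J : GrothendieckTopology E) [J.Subcanonical]
    (R : E) [CommRingObj R] (hQ : SDG.ContainsRationals R) (hKL : SDG.IsKL (𝟙 R))
    (M : E) (hM : SDG.IsFormalManifold J R M)
    (Φ : SDG.GroupoidObj M) (hΦ : Φ.IsLocallyTrivial J R)
    (conn : SDG.Connection J R Φ) (hflat : conn.IsFlat) (n : ℕ) :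
    (conn.iterate n).IsHolonomous := by
  intro X x y h0 hn
  obtain ⟨S, hS, hP⟩ := SDG.exists_patch hM hΦ (x.pt 0)
  refine SDG.hom_ext_of_cover hS fun Y f hf => ?_
  obtain ⟨P, p, hp⟩ := hP f hf
  have h := P.transport_eq hQ hKL hflat (x.restrict f) (y.restrict f)
    (congrArg (f ≫ ·) h0) (congrArg (f ≫ ·) hn) p hp
  rwa [conn.transport_natural, conn.transport_natural] at h
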